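/- Let $n=2m+1>1$ and let $S_n$ be the set of permutations of $N=\{1,\dots,n\}$. For nonempty $A\subseteq N$ let $\mathrm{diam}(A)=\max A-\min A$, and for a nonempty collection $\mathcal A$ of subsets of $N$ with at least two elements each and $\pi\in S_n$ let $$s^*_{\mathcal A}(\pi)=\Bigl(\prod_{A\in\mathcal A}\frac{\mathrm{diam}(\pi(A))}{\mathrm{diam}(A)}\Bigr)^{1/|\mathcal A|}.$$ Let $\mathcal B=\{\{i,i+1\}: 1\le i<n\}$, so that $s^*_{\mathcal B}(\pi)=\bigl(\prod_{i=1}^{n-1}|\pi(i)-\pi(i+1)|\bigr)^{1/(n-1)}$ is the geometric mean of the numbers $|\pi(i)-\pi(i+1)|$. Define maps $\rho,\sigma:N\to N$ as follows (in each list the first case that applies is used). If $m$ is odd: $$\rho(i)=\begin{cases} i+1,& i=m,\\ i-(m+1),& i=m+2,\\ i+m,& i\text{ even},\ i<m+2,\\ i+(m+2),& i\text{ odd},\ i<m,\\ i-m,& i\text{ even},\ i>m+1,\\ i-(m+2),& i\text{ odd},\ i>m+2,\end{cases}\qquad \sigma(i)=\begin{cases} i+1,& i=m+1,\\ i-(m+1),&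 i=2m+1,\\ i+m,& i\text{ odd},\ i<m+1,\\ i+(m+2),& i\text{ even},\ i<m+1,\\ i-m,& i\text{ odd},\ i>m+1,\\ i-(m+2),& i\text{ even},\ i>m+1.\end{cases}$$ If $m$ is even: $$\rho(i)=\begin{cases} i+1,& i=m,\\ i+(m+1),& i=1,\\ i+m,& i\text{ odd},\ 1<i<m+2,\\ i+(m+2),& i\text{ even},\ i<m,\\ i-m,& i\text{ even},\ i>m+1,\\ i-(m+2),& i\text{ odd},\ i>m+2,\end{cases}\qquad \sigma(i)=\begin{cases} i+1,& i=m+1,\\ i+(m+1),& i=m,\\ i+m,& i\text{ odd},\ i<m,\\ i+(m+2),& i\text{ even},\ i<m,\\ i-m,& i\text{ even},\ i>m+1,\\ i-(m+2),& i\text{ odd},\ i>m+1.\end{cases}$$ Then $\rho$ and $\sigma$ are $n$-cycles. Let $\alpha\in S_n$ be the permutation obtained by reading $\rho$ from $m+1$, that is, $\alpha(1)=m+1$, $\alpha(i+1)=\rho(\alpha(i))$ for $1\le i<n$, and $\rho(\alpha(n))=\alpha(1)$. Let $\beta\in S_n$ be obtained in the same way by reading $\sigma$ from $m+2$. Call $(\pi(n),\dots,\pi(1))$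 the mirror image of $\pi=(\pi(1),\dots,\pi(n))$. **Theorem.** The maximum of $s^*_{\mathcal B}$ over $S_n$ is $$\bigl(m^m\,(m+1)\,(m+2)^{m-1}\bigr)^{1/(n-1)},$$ and the permutations attaining it are precisely $\alpha$, $\beta$ and their mirror images. These four permutations are pairwise distinct. -/

import Mathlib

/-- The diameter `max A - min A` of a finite set of indices (`0` for the empty set). -/
def indexDiam {n : ℕ} (A : Finset (Fin n)) : ℕ :=
  if h : A.Nonempty then (A.max' h : ℕ) - (A.min' h : ℕ) else 0

/-- The multiplicative stretch `s*` of the permutation `π` with respect to the collection `𝒜`: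
the geometric mean of `diam (π A) / diam A` over `A ∈ 𝒜`. -/
noncomputable def mulStretch {n : ℕ} (𝒜 : Finset (Finset (Fin n))) (π : Equiv.Perm (Fin n)) : ℝ :=
  (∏ A ∈ 𝒜, (indexDiam (A.image π) : ℝ) / (indexDiam A : ℝ)) ^ (1 / (𝒜.card : ℝ))

/-- The collection of all pairs `{i, i + 1}` of neighbours in a set of `k + 1` indices. -/
def neighbourPairs (k : ℕ) : Finset (Finset (Fin (k + 1))) :=
  Finset.univ.image fun i : Fin k => {i.castSucc, i.succ}

/-- The first extremal cycle on the labels `1, …, 2m + 1`. Its short jump is `m ↦ m + 1`. -/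
def cycleA (m i : ℕ) : ℕ :=
  if Odd m then
    if i = m then i + 1
    else if i = m + 2 then i - (m + 1)
    else if Even i ∧ i < m + 2 then i + m
    else if Odd i ∧ i < m then i + (m + 2)
    else if Even i ∧ m + 1 < i then i - m
    else i - (m + 2)
  else
    if i = m then i + 1
    else if i = 1 then i + (m + 1)
    else if Odd i ∧ i < m + 2 then i + m
    else if Even i ∧ i < m then i + (m + 2)
    else if Even i ∧ m + 1 < i then i - m
    else i - (m + 2)

/-- The second extremal cycle on the labels `1, …, 2m + 1`. Its short jump is `m + 1 ↦ m + 2`. -/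
def cycleB (m i : ℕ) : ℕ :=
  if Odd m then
    if i = m + 1 then i + 1
    else if i = 2 * m + 1 then i - (m + 1)
    else if Odd i ∧ i < m + 1 then i + m
    else if Even i ∧ i < m + 1 then i + (m + 2)
    else if Odd i ∧ m + 1 < i then i - m
    else i - (m + 2)
  else
    if i = m + 1 then i + 1
    else if i = m then i + (m + 1)
    else if Odd i ∧ i < m then i + m
    else if Even i ∧ i < m then i + (m + 2)
    else if Even i ∧ m + 1 < i then i - m
    else i - (m + 2)

/-- The permutation `π` of `1, …, k + 1` corresponds to the cycle `ρ` with designated beginning `c`: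
`π(1) = c`, `ρ(π(i)) = π(i + 1)` for `i ≤ k`, and `ρ(π(k + 1)) = π(1)`. The element `j` of
`Fin (k + 1)` stands for the label `j + 1`, and `finRotate` is the cyclic successor. -/
def ReadsCycle {k : ℕ} (ρ : ℕ → ℕ) (c : ℕ) (π : Equiv.Perm (Fin (k + 1))) : Prop :=
  (π 0 : ℕ) + 1 = c ∧ ∀ i : Fin (k + 1), ρ ((π i : ℕ) + 1) = (π (finRotate (k + 1) i) : ℕ) + 1

/-- The mirror image `(π(n), …, π(1))` of the permutation `(π(1), …, π(n))`. -/
def mirrorImage {n : ℕ} (π : Equiv.Perm (Fin n)) : Equiv.Perm (Fin n) :=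
  Fin.revPerm.trans π

/-! Labels and places are shifted to `0, …, 2m`, and a permutation is treated as a Hamiltonian path
`p` on the labels. The function `log (y - x)` is a sum of weights over all intervals `[a, b]`
containing `[x, y]`, so the logarithm of the product is the sum of `intervalWeight` times
`edgesWithin` (`sum_log_edgeLength`). By concavity of `log` every weight with `a < b` is negative
except that of the full interval, whose count is the same for all paths. A maximiser should
therefore have as few edges as possible inside each interval.

Counting gives at least `2 (b - a - m)` edges in `[a, b]` (`le_edgesWithin`). The path `zigzag`
attains the larger of this and `0`, except on `[a, a + m]` with `1 ≤ a ≤ m`, where it has one edge.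
An edge-free interval of `m + 1` labels must occupy exactly the even places, so a path has at most
one (`eq_of_edgesWithin_eq_zero`). If `p` has none, or it is `[0, m]`, all its counts dominate those
of `zigzag`. If it is `[m, 2m]`, reflecting the values reduces to that case. If it is `[c, c + m]`
with `0 < c < m`, the gain there is outweighed by the loss at `[0, m]`, whose weight is more
negative (`intervalWeight_prefix_lt`). In case of equality all counts agree; they determine the
edges, and the edges determine the path up to reversal. -/

open Finset

/-! ### Edge counts of a path inside intervals of labels -/

/-- The number of edges `{p i, p (i + 1)}`, `i < k`, of the path `p` that lie in `[a, b]`. -/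
def edgesWithin (p : ℕ → ℕ) (k a b : ℕ) : ℕ :=
  ∑ i ∈ range k, if a ≤ min (p i) (p (i + 1)) ∧ max (p i) (p (i + 1)) ≤ b then 1 else 0

/-- The length of the `i`-th edge of the path `p`. -/
def edgeLength (p : ℕ → ℕ) (i : ℕ) : ℕ := max (p i) (p (i + 1)) - min (p i) (p (i + 1))

/-- `p` lists each of `0, …, k` exactly once at the places `0, …, k`. -/
def IsListing (p : ℕ → ℕ) (k : ℕ) : Prop :=
  (∀ i ≤ k, p i ≤ k) ∧ ∀ i ≤ k, ∀ j ≤ k, p i = p j → i = j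

lemma IsListing.exists_eq {p : ℕ → ℕ} {k : ℕ} (hp : IsListing p k) {x : ℕ} (hx : x ≤ k) :
    ∃ i ≤ k, p i = x := by
  have h := Finset.surj_on_of_inj_on_of_card_le (s := range (k + 1)) (t := range (k + 1))
    (fun i _ => p i) (fun i hi => by have := hp.1 i; simp at hi ⊢; omega)
    (fun i j hi hj h => hp.2 i (by simp at hi; omega) j (by simp at hj; omega) h) le_rfl
    x (by simp; omega)
  obtain ⟨i, hi, h⟩ := h
  exact ⟨i, by simp at hi; omega, h.symm⟩

lemma IsListing.card_filter {p : ℕ → ℕ} {k : ℕ} (hp : IsListing p k) (P : ℕ → Prop)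
    [DecidablePred P] :
    ((range (k + 1)).filter fun i => P (p i)).card = ((range (k + 1)).filter P).card := by
  refine Finset.card_bij (fun i _ => p i) ?_ ?_ ?_
  · intro i hi
    have := hp.1 i
    simp at hi ⊢
    exact ⟨by omega, hi.2⟩
  · intro i hi j hj h
    simp at hi hj
    exact hp.2 i (by omega) j (by omega) h
  · intro x hx
    simp at hx
    obtain ⟨i, hi, rfl⟩ := hp.exists_eq (x := x) (by omega)
    exact ⟨i, by simp; exact ⟨by omega, hx.2⟩, rfl⟩

lemma card_filter_between {k a b : ℕ} (hab : a ≤ b) (hb : b ≤ k) :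
    ((range (k + 1)).filter fun x => a ≤ x ∧ x ≤ b).card = b - a + 1 := by
  have : ((range (k + 1)).filter fun x => a ≤ x ∧ x ≤ b) = Icc a b := by
    ext x; simp; omega
  rw [this, Nat.card_Icc]; omega

/-- Exactly `k - (b - a)` places carry labels outside `[a, b]`, and each of them spoils at most two
of the `k` edges. -/
lemma le_edgesWithin {p : ℕ → ℕ} {k a b : ℕ} (hp : IsListing p k) (hab : a ≤ b) (hb : b ≤ k) :
    2 * (b - a) ≤ edgesWithin p k a b + k := by
  have hout : ∑ i ∈ range (k + 1), (if a ≤ p i ∧ p i ≤ b then 0 else 1) = k - (b - a) := by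
    have h1 : ∑ i ∈ range (k + 1), (if a ≤ p i ∧ p i ≤ b then 1 else 0) = b - a + 1 := by
      rw [← Finset.card_filter, hp.card_filter (fun x => a ≤ x ∧ x ≤ b),
        card_filter_between hab hb]
    have h2 : ∑ i ∈ range (k + 1), (if a ≤ p i ∧ p i ≤ b then 0 else 1) +
        ∑ i ∈ range (k + 1), (if a ≤ p i ∧ p i ≤ b then 1 else 0) = k + 1 := by
      rw [← sum_add_distrib]
      trans ∑ i ∈ range (k + 1), 1
      · exact sum_congr rfl fun i _ => by split_ifs <;> rfl
      · simp
    omega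
  have h1 := sum_range_succ (fun i => if a ≤ p i ∧ p i ≤ b then 0 else 1) k
  have h2 := sum_range_succ' (fun i => if a ≤ p i ∧ p i ≤ b then 0 else 1) k
  have h3 : k ≤ edgesWithin p k a b + ∑ i ∈ range k, (if a ≤ p i ∧ p i ≤ b then 0 else 1) +
      ∑ i ∈ range k, (if a ≤ p (i + 1) ∧ p (i + 1) ≤ b then 0 else 1) := by
    rw [edgesWithin, ← sum_add_distrib, ← sum_add_distrib]
    calc k = ∑ i ∈ range k, 1 := by simp
      _ ≤ _ := sum_le_sum fun i _ => by split_ifs <;> omega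
  omega

lemma edgesWithin_univ {p : ℕ → ℕ} {k : ℕ} (hp : IsListing p k) : edgesWithin p k 0 k = k := by
  rw [edgesWithin]
  trans ∑ i ∈ range k, 1
  · refine sum_congr rfl fun i hi => ?_
    rw [mem_range] at hi
    have := hp.1 i; have := hp.1 (i + 1)
    rw [if_pos (by omega)]
  · simp

/-- If no edge lies in an interval of `m + 1` labels, the path visits it at the even places. -/
lemma even_of_edgesWithin_eq_zero {p : ℕ → ℕ} {m a : ℕ} (hp : IsListing p (2 * m)) (ha : a ≤ m)
    (h : edgesWithin p (2 * m) a (a + m) = 0) {i : ℕ} (hi : i ≤ 2 * m)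
    (hia : a ≤ p i ∧ p i ≤ a + m) : Even i := by
  by_contra hodd
  have key : ∀ j < 2 * m, a ≤ p j ∧ p j ≤ a + m → a ≤ p (j + 1) ∧ p (j + 1) ≤ a + m → False := by
    intro j hj h1 h2
    have := (sum_eq_zero_iff.1 h) j (by simpa using hj)
    rw [if_pos (by omega)] at this
    omega
  -- As `i` is odd, this map cuts the places into `m` blocks: adjacent pairs, and the triple `i - 1,
  -- i, i + 1`. Each block holds at most one visit, because the visit at `i` excludes both of its
  -- neighbours. But there are `m + 1` visits.
  have hlt : ∀ j j', j < j' → j' ≤ 2 * m → (a ≤ p j ∧ p j ≤ a + m) →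
      (a ≤ p j' ∧ p j' ≤ a + m) →
      (if j ≤ i then j / 2 else (j - 1) / 2) ≠ if j' ≤ i then j' / 2 else (j' - 1) / 2 := by
    intro j j' hlt hj' hpj hpj' hjj
    rw [Nat.not_even_iff] at hodd
    have h1 : j' = j + 1 ∨ (j + 1 = i ∧ j' = i + 1) := by split_ifs at hjj <;> omega
    rcases h1 with rfl | ⟨h1, h2⟩
    · exact key j (by omega) hpj hpj'
    · subst h1
      exact key j (by omega) hpj hia
  have hle : ((range (2 * m + 1)).filter fun j => a ≤ p j ∧ p j ≤ a + m).card ≤ (range m).card := by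
    refine card_le_card_of_injOn (fun j => if j ≤ i then j / 2 else (j - 1) / 2) ?_ ?_
    · intro j hj
      simp at hj ⊢
      rw [Nat.not_even_iff] at hodd
      split_ifs <;> omega
    · intro j hj j' hj' hjj
      simp only [coe_filter, mem_range, Set.mem_ofPred_eq] at hj hj'
      rcases lt_trichotomy j j' with h1 | h1 | h1
      · exact absurd hjj (hlt j j' h1 (by omega) hj.2 hj'.2)
      · exact h1
      · exact absurd hjj.symm (hlt j' j h1 (by omega) hj'.2 hj.2)
  rw [hp.card_filter (fun x => a ≤ x ∧ x ≤ a + m), card_filter_between (by omega) (by omega)] at hle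
  simp at hle

/-- Both intervals have `m + 1` labels and there are only `m + 1` even places, so both consist of
exactly the labels at even places. -/
lemma eq_of_edgesWithin_eq_zero {p : ℕ → ℕ} {m a c : ℕ} (hp : IsListing p (2 * m)) (ha : a ≤ m)
    (hc : c ≤ m) (h : edgesWithin p (2 * m) a (a + m) = 0)
    (h' : edgesWithin p (2 * m) c (c + m) = 0) : a = c := by
  have hE : ((range (2 * m + 1)).filter Even).card ≤ m + 1 := by
    rw [← card_range (m + 1)]
    refine card_le_card_of_injOn (fun j => j / 2) ?_ ?_
    · intro j hj
      simp at hj ⊢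
      omega
    · intro j hj j' hj' hjj
      simp [Nat.even_iff] at hj hj' hjj
      omega
  have key : ∀ b ≤ m, edgesWithin p (2 * m) b (b + m) = 0 →
      ((range (2 * m + 1)).filter fun j => b ≤ p j ∧ p j ≤ b + m) =
        (range (2 * m + 1)).filter Even := by
    intro b hb hb0
    refine eq_of_subset_of_card_le ?_ ?_
    · intro j hj
      simp at hj ⊢
      exact ⟨hj.1, even_of_edgesWithin_eq_zero hp hb hb0 (by omega) hj.2⟩
    · rw [hp.card_filter (fun x => b ≤ x ∧ x ≤ b + m), card_filter_between (by omega) (by omega)]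
      omega
  have heq := (key a ha h).trans (key c hc h').symm
  have hmem : ∀ x ≤ 2 * m, (a ≤ x ∧ x ≤ a + m) ↔ (c ≤ x ∧ x ≤ c + m) := by
    intro x hx
    obtain ⟨i, hi, rfl⟩ := hp.exists_eq hx
    have := Finset.ext_iff.1 heq i
    simp only [mem_filter, mem_range] at this
    have hi' : i < 2 * m + 1 := by omega
    tauto
  have h1 := (hmem a (by omega)).1 (by omega)
  have h2 := (hmem c (by omega)).2 (by omega)
  omega

lemma IsListing.ne_succ {p : ℕ → ℕ} {k i : ℕ} (hp : IsListing p k) (hi : i < k) :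
    p i ≠ p (i + 1) := fun h => by
  have := hp.2 i hi.le (i + 1) hi h
  omega

lemma edgesWithin_eq_zero {p : ℕ → ℕ} {k a b : ℕ} (hp : IsListing p k) (hab : b ≤ a) :
    edgesWithin p k a b = 0 := by
  refine sum_eq_zero fun j hj => ?_
  have := hp.ne_succ (mem_range.1 hj)
  rw [if_neg (by omega)]

/-- The interval counts determine the edges. -/
lemma exists_edge_eq {p q : ℕ → ℕ} {k : ℕ} (hp : IsListing p k)
    (hq : IsListing q k)
    (h : ∀ a b, a < b → b ≤ k → edgesWithin p k a b = edgesWithin q k a b) {i : ℕ} (hi : i < k) :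
    ∃ j < k, min (q j) (q (j + 1)) = min (p i) (p (i + 1)) ∧
      max (q j) (q (j + 1)) = max (p i) (p (i + 1)) := by
  set x := min (p i) (p (i + 1)) with hx
  set y := max (p i) (p (i + 1)) with hy
  have hne := hp.ne_succ hi
  have hyk : y ≤ k := max_le (hp.1 i hi.le) (hp.1 _ hi)
  have hxy : x < y := by omega
  -- Inclusion–exclusion: an edge inside `[x, y]` but in neither `[x + 1, y]` nor `[x, y - 1]` is
  -- `{x, y}` itself.
  have hinv : ∀ r : ℕ → ℕ, edgesWithin r k x y + edgesWithin r k (x + 1) (y - 1) =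
      edgesWithin r k (x + 1) y + edgesWithin r k x (y - 1) +
      ∑ j ∈ range k, if min (r j) (r (j + 1)) = x ∧ max (r j) (r (j + 1)) = y then 1 else 0 := by
    intro r
    simp only [edgesWithin, ← sum_add_distrib]
    refine sum_congr rfl fun j _ => ?_
    generalize hu : min (r j) (r (j + 1)) = u
    generalize hv : max (r j) (r (j + 1)) = v
    split_ifs <;> omega
  have htriv : ∀ a b, b ≤ k → edgesWithin p k a b = edgesWithin q k a b := by
    intro a b hb
    rcases lt_or_ge a b with hab | hab
    · exact h a b hab hb
    · rw [edgesWithin_eq_zero hp hab, edgesWithin_eq_zero hq hab]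
  have h1 := hinv p
  have h2 := hinv q
  rw [htriv _ _ hyk, htriv _ _ hyk, htriv _ (y - 1) (by omega), htriv _ (y - 1) (by omega)] at h1
  have h3 : 0 < ∑ j ∈ range k,
      if min (p j) (p (j + 1)) = x ∧ max (p j) (p (j + 1)) = y then 1 else 0 := by
    refine sum_pos' (fun _ _ => Nat.zero_le _) ⟨i, by simpa using hi, ?_⟩
    rw [if_pos ⟨rfl, rfl⟩]
    exact one_pos
  by_contra hcon
  push Not at hcon
  have h4 : ∑ j ∈ range k,
      (if min (q j) (q (j + 1)) = x ∧ max (q j) (q (j + 1)) = y then 1 else 0) = 0 := by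
    refine sum_eq_zero fun j hj => ?_
    rw [if_neg]
    rintro ⟨h5, h6⟩
    exact hcon j (by simpa using hj) h5 h6
  omega

/-! ### The extremal path and its edge counts -/

/-- The first extremal path, on the labels `0, …, 2m`. -/
def zigzag (m i : ℕ) : ℕ :=
  if Even i then if i ≤ m then m - i else i - (m + 1)
  else if i ≤ m then 2 * m + 1 - i else i

lemma isListing_zigzag (m : ℕ) : IsListing (zigzag m) (2 * m) := by
  constructor
  · intro i hi
    simp only [zigzag, Nat.even_iff]
    split_ifs <;> omega
  · intro i hi j hj h
    simp only [zigzag, Nat.even_iff] at h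
    split_ifs at h <;> omega

lemma zigzag_edge (m i : ℕ) (hi : i < 2 * m) :
    min (zigzag m i) (zigzag m (i + 1)) =
      (if Even i then if i ≤ m then m - i else i - (m + 1)
        else if i + 1 ≤ m then m - (i + 1) else i - m) ∧
    edgeLength (zigzag m) i =
      if i = m then m + 1 else if (Even i ↔ i < m) then m else m + 2 := by
  simp only [edgeLength, zigzag, Nat.even_iff]
  split_ifs <;> omega

lemma edgesWithin_zigzag_of_lt {m a b : ℕ} (h : b < a + m) :
    edgesWithin (zigzag m) (2 * m) a b = 0 := by
  refine sum_eq_zero fun i hi => ?_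
  have h1 := (zigzag_edge m i (by simpa using hi)).2
  simp only [edgeLength] at h1
  rw [if_neg]
  split_ifs at h1 <;> omega

/-- Edges of length `m` have distinct lower ends, and label `0` is never one of them. Hence the `max
a 1`, which leaves `[0, m]` without edges. -/
lemma card_zigzag_edges_short (m a b : ℕ) :
    ((range (2 * m)).filter fun i => (a ≤ min (zigzag m i) (zigzag m (i + 1)) ∧
      max (zigzag m i) (zigzag m (i + 1)) ≤ b) ∧ edgeLength (zigzag m) i = m).card
      ≤ b + 1 - m - max a 1 := by
  rw [← Nat.card_Ico]
  refine card_le_card_of_injOn (fun i => min (zigzag m i) (zigzag m (i + 1))) ?_ ?_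
  · intro i hi
    simp only [coe_filter, mem_range, Set.mem_ofPred_eq] at hi
    have h := zigzag_edge m i hi.1
    simp only [edgeLength, Nat.even_iff] at h hi
    simp only [coe_Ico, Set.mem_Ico]
    split_ifs at h <;> omega
  · intro i hi j hj hij
    simp only [coe_filter, mem_range, Set.mem_ofPred_eq] at hi hj
    have h := zigzag_edge m i hi.1
    have h' := zigzag_edge m j hj.1
    dsimp only at hij
    rw [h.1, h'.1] at hij
    rw [h.2] at hi
    rw [h'.2] at hj
    simp only [Nat.even_iff] at hij hi hj
    replace hi := hi.2.2
    replace hj := hj.2.2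
    split_ifs at hij hi hj <;> omega

lemma card_zigzag_edges_long (m a b : ℕ) :
    ((range (2 * m)).filter fun i => (a ≤ min (zigzag m i) (zigzag m (i + 1)) ∧
      max (zigzag m i) (zigzag m (i + 1)) ≤ b) ∧ edgeLength (zigzag m) i = m + 2).card
      ≤ b - (m + 1) - a := by
  rw [← Nat.card_Ico]
  refine card_le_card_of_injOn (fun i => min (zigzag m i) (zigzag m (i + 1))) ?_ ?_
  · intro i hi
    simp only [coe_filter, mem_range, Set.mem_ofPred_eq] at hi
    simp only [edgeLength] at hi
    simp only [coe_Ico, Set.mem_Ico]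
    omega
  · intro i hi j hj hij
    simp only [coe_filter, mem_range, Set.mem_ofPred_eq] at hi hj
    have h := zigzag_edge m i hi.1
    have h' := zigzag_edge m j hj.1
    dsimp only at hij
    rw [h.1, h'.1] at hij
    rw [h.2] at hi
    rw [h'.2] at hj
    simp only [Nat.even_iff] at hij hi hj
    replace hi := hi.2.2
    replace hj := hj.2.2
    split_ifs at hij hi hj <;> omega

/-- The only edge of length `m + 1` is `{0, m + 1}`, at place `m`. -/
lemma card_zigzag_edges_middle (m a b : ℕ) :
    ((range (2 * m)).filter fun i => (a ≤ min (zigzag m i) (zigzag m (i + 1)) ∧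
      max (zigzag m i) (zigzag m (i + 1)) ≤ b) ∧ edgeLength (zigzag m) i = m + 1).card
      ≤ if a = 0 ∧ m + 1 ≤ b then 1 else 0 := by
  have hm : ∀ i < 2 * m, edgeLength (zigzag m) i = m + 1 → i = m := by
    intro i hi h
    rw [(zigzag_edge m i hi).2] at h
    split_ifs at h <;> omega
  split_ifs with h
  · refine (card_le_card (t := {m}) fun i hi => ?_).trans (card_singleton m).le
    simp only [mem_filter, mem_range] at hi
    exact mem_singleton.2 (hm i hi.1 hi.2.2)
  · rw [Nat.le_zero, card_eq_zero, filter_eq_empty_iff]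
    rintro i hi ⟨h1, h2⟩
    rw [mem_range] at hi
    obtain rfl := hm i hi h2
    have h3 := zigzag_edge i i hi
    simp only [edgeLength] at h2 h3
    rw [h3.1] at h1
    split_ifs at h1 h3 <;> omega

lemma edgesWithin_zigzag_le (m a b : ℕ) :
    edgesWithin (zigzag m) (2 * m) a b ≤ (b + 1 - m - max a 1) + (b - (m + 1) - a) +
      if a = 0 ∧ m + 1 ≤ b then 1 else 0 := by
  refine le_trans ?_ (add_le_add (add_le_add (card_zigzag_edges_short m a b)
    (card_zigzag_edges_long m a b)) (card_zigzag_edges_middle m a b))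
  simp only [edgesWithin, card_filter, ← sum_add_distrib]
  refine sum_le_sum fun i hi => ?_
  have h : edgeLength (zigzag m) i = m ∨ edgeLength (zigzag m) i = m + 1 ∨
      edgeLength (zigzag m) i = m + 2 := by
    rw [(zigzag_edge m i (by simpa using hi)).2]
    split_ifs <;> simp
  by_cases hin : a ≤ min (zigzag m i) (zigzag m (i + 1)) ∧
      max (zigzag m i) (zigzag m (i + 1)) ≤ b
  · simp only [hin, true_and]
    rcases h with h | h | h <;> simp [h]
  · rw [if_neg hin]
    exact Nat.zero_le _

lemma edgesWithin_zigzag_zero (m : ℕ) : edgesWithin (zigzag m) (2 * m) 0 m = 0 := by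
  have := edgesWithin_zigzag_le m 0 m
  rw [if_neg (by omega)] at this
  omega

lemma edgesWithin_zigzag_le_one (m a : ℕ) : edgesWithin (zigzag m) (2 * m) a (a + m) ≤ 1 := by
  have := edgesWithin_zigzag_le m a (a + m)
  rw [if_neg (by omega)] at this
  omega

/-- For `b < a + m` the zigzag has no edge in `[a, b]`; for `b > a + m` it meets the bound of
`le_edgesWithin`. The case `b = a + m` is excluded because that bound is then `0`, while the zigzag
may have an edge. -/
lemma edgesWithin_zigzag_le_edgesWithin {m a b : ℕ} {p : ℕ → ℕ} (hp : IsListing p (2 * m))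
    (hab : a < b) (hb : b ≤ 2 * m) (hne : b ≠ a + m) :
    edgesWithin (zigzag m) (2 * m) a b ≤ edgesWithin p (2 * m) a b := by
  rcases lt_or_ge b (a + m) with h | h
  · rw [edgesWithin_zigzag_of_lt h]; exact Nat.zero_le _
  · have h1 := edgesWithin_zigzag_le m a b
    have h2 := le_edgesWithin hp hab.le hb
    split_ifs at h1 <;> omega

lemma prod_edgeLength_zigzag (m : ℕ) (hm : 1 ≤ m) :
    ∏ i ∈ range (2 * m), edgeLength (zigzag m) i = m ^ m * (m + 1) * (m + 2) ^ (m - 1) := by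
  obtain ⟨k, rfl⟩ : ∃ k, m = k + 1 := ⟨m - 1, by omega⟩
  have hlen : ∀ i < 2 * (k + 1), edgeLength (zigzag (k + 1)) i =
      if i = k + 1 then k + 2 else if (Even i ↔ i < k + 1) then k + 1 else k + 3 :=
    fun i hi => (zigzag_edge (k + 1) i hi).2
  -- With `m = k + 1`, edge `0` has length `m` and edge `m` has length `m + 1`. The others are
  -- paired as `i` and `2m - i`, one of length `m` and one of length `m + 2`.
  have hsplit : 2 * (k + 1) = (1 + k) + 1 + k := by ring
  rw [hsplit, prod_range_add, prod_range_succ, prod_range_add, 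
    ← prod_range_reflect (fun x => edgeLength (zigzag (k + 1)) (1 + k + 1 + x)) k]
  have hmul : (∏ x ∈ range k, edgeLength (zigzag (k + 1)) (1 + x)) *
      ∏ x ∈ range k, edgeLength (zigzag (k + 1)) (1 + k + 1 + (k - 1 - x)) =
      ((k + 1) * (k + 3)) ^ k := by
    rw [← prod_mul_distrib]
    trans ∏ x ∈ range k, ((k + 1) * (k + 3))
    · refine prod_congr rfl fun i hi => ?_
      rw [mem_range] at hi
      have h1 := hlen (1 + i) (by omega)
      have h2 := hlen (1 + k + 1 + (k - 1 - i)) (by omega)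
      rw [if_neg (by omega)] at h1 h2
      rw [h1, h2]
      simp only [Nat.even_iff]
      by_cases h : (1 + i) % 2 = 0
      · rw [if_pos (by omega), if_neg (by omega)]
      · rw [if_neg (by omega), if_pos (by omega), mul_comm]
    · simp
  have h0 : edgeLength (zigzag (k + 1)) 0 = k + 1 := by
    rw [hlen 0 (by omega), if_neg (by omega), if_pos (by simp)]
  have h1 : edgeLength (zigzag (k + 1)) (1 + k) = k + 2 := by
    rw [hlen _ (by omega), if_pos (by omega)]
  rw [prod_range_one, h0, h1]
  generalize (∏ x ∈ range k, edgeLength (zigzag (k + 1)) (1 + x)) = A at hmul ⊢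
  generalize (∏ x ∈ range k, edgeLength (zigzag (k + 1)) (1 + k + 1 + (k - 1 - x))) = B at hmul ⊢
  calc (k + 1) * A * (k + 2) * B = (k + 1) * (k + 2) * (A * B) := by ring
    _ = _ := by rw [hmul, mul_pow, Nat.add_sub_cancel]; ring

/-! ### Logarithms of lengths as sums of interval weights -/

/-- The logarithm of the number of elements of `[a - 1, b)`, `0` if this leaves `[0, N]`. -/
noncomputable def cornerLog (N a b : ℕ) : ℝ :=
  if a = 0 ∨ N < b then 0 else Real.log ((b : ℝ) + 1 - a)

/-- The weights whose sum over the intervals `[a, b] ⊇ [x, y]` in `[0, N]` is `log (y - x)`. -/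
noncomputable def intervalWeight (N a b : ℕ) : ℝ :=
  cornerLog N (a + 1) b - cornerLog N a b - (cornerLog N (a + 1) (b + 1) - cornerLog N a (b + 1))

/-- The weight is a mixed second difference of `cornerLog`, so both sums telescope. `cornerLog`
vanishes at `a = 0` and at `b = N + 1`, so only the corner `(x + 1, y)` remains. -/
lemma sum_intervalWeight {N x y : ℕ} (hxN : x ≤ N) (hy : y ≤ N) :
    ∑ a ∈ range (N + 1), ∑ b ∈ range (N + 1), (if a ≤ x ∧ y ≤ b then intervalWeight N a b else 0) =
      Real.log ((y : ℝ) - x) := by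
  have hcol : ∀ a, ∑ b ∈ Ico y (N + 1), intervalWeight N a b =
      cornerLog N (a + 1) y - cornerLog N a y := by
    intro a
    have h := sum_Ico_sub (fun b => cornerLog N (a + 1) b - cornerLog N a b)
      (show y ≤ N + 1 by omega)
    have h1 : ∀ c, cornerLog N c (N + 1) = 0 := fun c => if_pos (Or.inr (by omega))
    rw [h1, h1] at h
    calc _ = -∑ b ∈ Ico y (N + 1), ((cornerLog N (a + 1) (b + 1) - cornerLog N a (b + 1)) -
          (cornerLog N (a + 1) b - cornerLog N a b)) := by
          rw [← sum_neg_distrib]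
          exact sum_congr rfl fun b _ => by rw [intervalWeight]; ring
      _ = _ := by rw [h]; ring
  have hrow : ∀ a ∈ range (N + 1),
      ∑ b ∈ range (N + 1), (if a ≤ x ∧ y ≤ b then intervalWeight N a b else 0) =
      if a ≤ x then cornerLog N (a + 1) y - cornerLog N a y else 0 := by
    intro a _
    split_ifs with ha
    · rw [← hcol, ← sum_filter]
      refine sum_congr ?_ fun _ _ => rfl
      ext b; simp; omega
    · exact sum_eq_zero fun b _ => if_neg fun h => ha h.1
  rw [sum_congr rfl hrow, ← sum_filter]
  have : (range (N + 1)).filter (fun a => a ≤ x) = range (x + 1) := by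
    ext a; simp; omega
  rw [this, sum_range_sub (fun a => cornerLog N a y)]
  simp only [cornerLog]
  rw [if_neg (by omega), if_pos (by simp)]
  push_cast
  ring_nf

/-- The sum of the weights of an interval over all edges of a path. -/
lemma sum_log_edgeLength {p : ℕ → ℕ} {k : ℕ} (hp : IsListing p k) :
    ∑ i ∈ range k, Real.log (edgeLength p i) =
      ∑ q ∈ range (k + 1) ×ˢ range (k + 1), intervalWeight k q.1 q.2 * edgesWithin p k q.1 q.2 := by
  have h : ∀ i ∈ range k, Real.log (edgeLength p i) = ∑ q ∈ range (k + 1) ×ˢ range (k + 1),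
      intervalWeight k q.1 q.2 *
        (if q.1 ≤ min (p i) (p (i + 1)) ∧ max (p i) (p (i + 1)) ≤ q.2 then 1 else 0 : ℕ) := by
    intro i hi
    rw [mem_range] at hi
    have h1 := hp.1 i hi.le
    have h2 := hp.1 (i + 1) hi
    rw [edgeLength, Nat.cast_sub (by omega), ← sum_intervalWeight (N := k) (by omega) (by omega),
      sum_product]
    refine sum_congr rfl fun a _ => sum_congr rfl fun b _ => ?_
    split_ifs <;> simp
  rw [sum_congr rfl h, sum_comm]
  refine sum_congr rfl fun q _ => ?_
  rw [← mul_sum, edgesWithin]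
  push_cast
  rfl

lemma log_add_log_add_two_lt {D : ℝ} (hD : 0 < D) :
    Real.log D + Real.log (D + 2) < 2 * Real.log (D + 1) := by
  rw [← Real.log_mul (by positivity) (by positivity), ← Real.log_rpow (by positivity)]
  refine Real.log_lt_log (by positivity) ?_
  norm_num
  nlinarith

lemma intervalWeight_interior {N a b : ℕ} (ha : 0 < a) (hb : b < N) :
    intervalWeight N a b = Real.log ((b : ℝ) - a) + Real.log ((b : ℝ) - a + 2) -
      2 * Real.log ((b : ℝ) - a + 1) := by
  simp only [intervalWeight, cornerLog]
  rw [if_neg (by omega), if_neg (by omega), if_neg (by omega), if_neg (by omega)]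
  push_cast
  ring_nf

lemma intervalWeight_prefix {N b : ℕ} (hb : b < N) :
    intervalWeight N 0 b = Real.log b - Real.log ((b : ℝ) + 1) := by
  simp only [intervalWeight, cornerLog]
  rw [if_neg (by omega), if_pos (by simp), if_neg (by omega), if_pos (by simp)]
  push_cast
  ring_nf

lemma intervalWeight_suffix {N a : ℕ} (ha : 0 < a) :
    intervalWeight N a N = Real.log ((N : ℝ) - a) - Real.log ((N : ℝ) - a + 1) := by
  simp only [intervalWeight, cornerLog]
  rw [if_neg (by omega), if_neg (by omega), if_pos (by omega), if_pos (by omega)]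
  push_cast
  ring_nf

lemma intervalWeight_neg {N a b : ℕ} (hab : a < b) (hb : b ≤ N) (h : a ≠ 0 ∨ b ≠ N) :
    intervalWeight N a b < 0 := by
  have hab' : (0 : ℝ) < (b : ℝ) - a := sub_pos.2 (by exact_mod_cast hab)
  rcases Nat.eq_zero_or_pos a with rfl | ha
  · rw [intervalWeight_prefix (by omega), sub_neg]
    simp only [Nat.cast_zero, sub_zero] at hab'
    exact Real.log_lt_log hab' (by linarith)
  · rcases hb.eq_or_lt with rfl | hb
    · rw [intervalWeight_suffix ha, sub_neg]
      exact Real.log_lt_log hab' (by linarith)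
    · rw [intervalWeight_interior ha hb, sub_neg]
      exact log_add_log_add_two_lt hab'

/-- The difference of the two weights is `log (d + 2) - log (d + 1)`. -/
lemma intervalWeight_prefix_lt {N c d : ℕ} (hc : 0 < c) (hd : 0 < d) (h : c + d < N) :
    intervalWeight N 0 d < intervalWeight N c (c + d) := by
  rw [intervalWeight_prefix (by omega), intervalWeight_interior hc h]
  have hd' : (0 : ℝ) < d := by exact_mod_cast hd
  push_cast
  rw [add_sub_cancel_left]
  have := Real.log_lt_log (show (0 : ℝ) < d + 1 by linarith) (show (d : ℝ) + 1 < d + 2 by linarith)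
  linarith

/-! ### Comparison with the extremal path -/

lemma sum_log_le_zigzag {m : ℕ} {p : ℕ → ℕ} (hp : IsListing p (2 * m))
    (h : ∀ c, 1 ≤ c → c ≤ m → 1 ≤ edgesWithin p (2 * m) c (c + m)) :
    ∑ i ∈ range (2 * m), Real.log (edgeLength p i) ≤
      ∑ i ∈ range (2 * m), Real.log (edgeLength (zigzag m) i) ∧
    (∑ i ∈ range (2 * m), Real.log (edgeLength p i) =
      ∑ i ∈ range (2 * m), Real.log (edgeLength (zigzag m) i) →
      ∀ a b, a < b → b ≤ 2 * m →
        edgesWithin p (2 * m) a b = edgesWithin (zigzag m) (2 * m) a b) := by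
  have hz := isListing_zigzag m
  have hle : ∀ a b, a < b → b ≤ 2 * m →
      edgesWithin (zigzag m) (2 * m) a b ≤ edgesWithin p (2 * m) a b := by
    intro a b hab hb
    by_cases hne : b = a + m
    · subst hne
      rcases Nat.eq_zero_or_pos a with rfl | ha
      · rw [zero_add, edgesWithin_zigzag_zero]; exact Nat.zero_le _
      · exact (edgesWithin_zigzag_le_one m a).trans (h a ha (by omega))
    · exact edgesWithin_zigzag_le_edgesWithin hp hab hb hne
  rw [sum_log_edgeLength hp, sum_log_edgeLength hz]
  have hterm : ∀ q ∈ range (2 * m + 1) ×ˢ range (2 * m + 1),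
      intervalWeight (2 * m) q.1 q.2 * edgesWithin p (2 * m) q.1 q.2 ≤
      intervalWeight (2 * m) q.1 q.2 * edgesWithin (zigzag m) (2 * m) q.1 q.2 := by
    rintro ⟨a, b⟩ hq
    simp only [mem_product, mem_range] at hq ⊢
    rcases lt_or_ge a b with hab | hab
    · by_cases hfull : a ≠ 0 ∨ b ≠ 2 * m
      · exact mul_le_mul_of_nonpos_left (by exact_mod_cast hle a b hab (by omega))
          (intervalWeight_neg hab (by omega) hfull).le
      · obtain ⟨rfl, rfl⟩ : a = 0 ∧ b = 2 * m := by omega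
        rw [edgesWithin_univ hp, edgesWithin_univ hz]
    · rw [edgesWithin_eq_zero hp hab, edgesWithin_eq_zero hz hab]
  refine ⟨sum_le_sum hterm, fun heq a b hab hb => ?_⟩
  have h1 := (sum_eq_sum_iff_of_le hterm).1 heq (a, b) (by simp; omega)
  by_cases hfull : a ≠ 0 ∨ b ≠ 2 * m
  -- Equality of the sums forces equality in every term, and the nonzero weight cancels.
  · exact_mod_cast mul_left_cancel₀ (intervalWeight_neg hab hb hfull).ne h1
  · obtain ⟨rfl, rfl⟩ : a = 0 ∧ b = 2 * m := by omega
    rw [edgesWithin_univ hp, edgesWithin_univ hz]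

lemma sum_log_lt_zigzag {m c : ℕ} {p : ℕ → ℕ} (hp : IsListing p (2 * m)) (hc : 0 < c) (hcm : c < m)
    (h : edgesWithin p (2 * m) c (c + m) = 0) :
    ∑ i ∈ range (2 * m), Real.log (edgeLength p i) <
      ∑ i ∈ range (2 * m), Real.log (edgeLength (zigzag m) i) := by
  have hz := isListing_zigzag m
  have hpos : ∀ a ≤ m, a ≠ c → 1 ≤ edgesWithin p (2 * m) a (a + m) := by
    intro a ha hac
    rw [Nat.one_le_iff_ne_zero]
    exact fun h0 => hac (eq_of_edgesWithin_eq_zero hp ha hcm.le h0 h)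
  set w := intervalWeight (2 * m) 0 m with hw
  have hwc : w < intervalWeight (2 * m) c (c + m) := intervalWeight_prefix_lt hc (by omega) (by omega)
  have hw0 : w < 0 := intervalWeight_neg (by omega) (by omega) (by omega)
  rw [sum_log_edgeLength hp, sum_log_edgeLength hz]
  set s := range (2 * m + 1) ×ˢ range (2 * m + 1) with hs
  have hmem0 : ((0, m) : ℕ × ℕ) ∈ s := by simp [hs]; omega
  have hmemc : (c, c + m) ∈ s := by simp [hs]; omega
  -- Moving the amount `w` from `(c, c + m)` to `(0, m)` makes a termwise comparison possible: `p`
  -- pays at least one `w` at `(0, m)`, while at `(c, c + m)` the zigzag pays at most one weight,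
  -- which is strictly less negative than `w`.
  have hshift : ∑ q ∈ s, ((if q = (0, m) then w else 0) - if q = (c, c + m) then w else 0) = 0 := by
    rw [sum_sub_distrib, sum_ite_eq' s, sum_ite_eq' s, if_pos hmem0, if_pos hmemc, sub_self]
  rw [← add_zero (∑ q ∈ s, intervalWeight (2 * m) q.1 q.2 * edgesWithin (zigzag m) (2 * m) q.1 q.2),
    ← hshift, ← sum_add_distrib]
  have hterm : ∀ a b, (a, b) ∈ s → (a, b) ≠ (c, c + m) →
      intervalWeight (2 * m) a b * edgesWithin p (2 * m) a b ≤
      intervalWeight (2 * m) a b * edgesWithin (zigzag m) (2 * m) a b +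
        ((if (a, b) = (0, m) then w else 0) - if (a, b) = (c, c + m) then w else 0) := by
    intro a b hq hne
    simp only [hs, mem_product, mem_range] at hq
    rw [if_neg hne, sub_zero]
    by_cases h0 : (a, b) = (0, m)
    · rw [if_pos h0]
      obtain ⟨rfl, rfl⟩ := Prod.mk.inj h0
      rw [edgesWithin_zigzag_zero, ← hw]
      have h1 := hpos 0 (by omega) hc.ne
      rw [zero_add] at h1
      have h2 : (1 : ℝ) ≤ edgesWithin p (2 * b) 0 b := by exact_mod_cast h1
      push_cast
      nlinarith
    · rw [if_neg h0, add_zero]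
      rcases lt_or_ge a b with hab | hab
      · by_cases hfull : a ≠ 0 ∨ b ≠ 2 * m
        · refine mul_le_mul_of_nonpos_left ?_ (intervalWeight_neg hab (by omega) hfull).le
          by_cases hbm : b = a + m
          · subst hbm
            have hac : a ≠ c := fun hac => hne (by rw [hac])
            exact_mod_cast (edgesWithin_zigzag_le_one m a).trans (hpos a (by omega) hac)
          · exact_mod_cast edgesWithin_zigzag_le_edgesWithin hp hab (by omega) hbm
        · obtain ⟨rfl, rfl⟩ : a = 0 ∧ b = 2 * m := by omega
          rw [edgesWithin_univ hp, edgesWithin_univ hz]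
      · rw [edgesWithin_eq_zero hp hab, edgesWithin_eq_zero hz hab]
  have hstrict : intervalWeight (2 * m) c (c + m) * edgesWithin p (2 * m) c (c + m) <
      intervalWeight (2 * m) c (c + m) * edgesWithin (zigzag m) (2 * m) c (c + m) +
        ((if (c, c + m) = (0, m) then w else 0) - if (c, c + m) = (c, c + m) then w else 0) := by
    rw [h, if_neg (by rw [Prod.mk.injEq]; omega), if_pos rfl]
    have h1 : (edgesWithin (zigzag m) (2 * m) c (c + m) : ℝ) ≤ 1 := by
      exact_mod_cast edgesWithin_zigzag_le_one m c
    have h2 : (0 : ℝ) ≤ edgesWithin (zigzag m) (2 * m) c (c + m) := Nat.cast_nonneg _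
    have h3 : intervalWeight (2 * m) c (c + m) < 0 :=
      intervalWeight_neg (by omega) (by omega) (by omega)
    push_cast
    nlinarith
  refine sum_lt_sum ?_ ⟨(c, c + m), hmemc, hstrict⟩
  rintro ⟨a, b⟩ hq
  by_cases hne : (a, b) = (c, c + m)
  · obtain ⟨rfl, rfl⟩ := Prod.mk.inj hne
    exact hstrict.le
  · exact hterm a b hq hne

/-! ### A path is determined by its edges up to reversal -/

/-- An injective walk with steps `±1` cannot turn back, so it is monotone; having to fit into `[0,
k]` then fixes its start. -/
lemma IsListing.eq_id_or_eq_rev {t : ℕ → ℕ} {k : ℕ} (ht : IsListing t k)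
    (hstep : ∀ i < k, t (i + 1) = t i + 1 ∨ t i = t (i + 1) + 1) :
    (∀ i ≤ k, t i = i) ∨ ∀ i ≤ k, t i = k - i := by
  rcases Nat.eq_zero_or_pos k with rfl | hk
  · left; intro i hi; have := ht.1 i hi; omega
  have hback : ∀ i, i + 2 ≤ k → t (i + 2) ≠ t i := by
    intro i hi h
    have := ht.2 _ hi i (by omega) h
    omega
  have hk' := ht.1 k le_rfl
  have h0 := ht.1 0 hk.le
  rcases hstep 0 hk with h | h
  · left
    have hup : ∀ i < k, t (i + 1) = t i + 1 := by
      intro i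
      induction i with
      | zero => intro _; exact h
      | succ i ih =>
        intro hi
        have := ih (by omega); have := hstep (i + 1) hi; have := hback i (by omega)
        rw [show i + 1 + 1 = i + 2 by rfl] at *
        omega
    have hlin : ∀ i ≤ k, t i = t 0 + i := by
      intro i
      induction i with
      | zero => intro _; rfl
      | succ i ih => intro hi; rw [hup i hi, ih (by omega)]; rfl
    intro i hi
    have := hlin k le_rfl; have := hlin i hi
    omega
  · right
    have hdown : ∀ i < k, t i = t (i + 1) + 1 := by
      intro i
      induction i with
      | zero => intro _; exact h
      | succ i ih =>
        intro hi
        have := ih (by omega); have := hstep (i + 1) hi; have := hback i (by omega)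
        rw [show i + 1 + 1 = i + 2 by rfl] at *
        omega
    have hlin : ∀ i ≤ k, t i + i = t 0 := by
      intro i
      induction i with
      | zero => intro _; rfl
      | succ i ih => intro hi; have := hdown i hi; have := ih (by omega); omega
    intro i hi
    have := hlin k le_rfl; have := hlin i hi
    omega

/-- Two paths with the same edges agree up to reversal. -/
lemma IsListing.eq_or_eq_rev {p q : ℕ → ℕ} {k : ℕ} (hp : IsListing p k) (hq : IsListing q k)
    (h : ∀ i < k, ∃ j < k, min (q j) (q (j + 1)) = min (p i) (p (i + 1)) ∧
      max (q j) (q (j + 1)) = max (p i) (p (i + 1))) :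
    (∀ i ≤ k, p i = q i) ∨ ∀ i ≤ k, p i = q (k - i) := by
  have hex : ∀ i, ∃ j, i ≤ k → j ≤ k ∧ q j = p i := by
    intro i
    by_cases hi : i ≤ k
    · obtain ⟨j, hj, hji⟩ := hq.exists_eq (hp.1 i hi)
      exact ⟨j, fun _ => ⟨hj, hji⟩⟩
    · exact ⟨0, fun h => absurd h hi⟩
  choose t ht using hex
  have htl : IsListing t k := by
    refine ⟨fun i hi => (ht i hi).1, fun i hi j hj hij => hp.2 i hi j hj ?_⟩
    rw [← (ht i hi).2, ← (ht j hj).2, hij]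
  have hstep : ∀ i < k, t (i + 1) = t i + 1 ∨ t i = t (i + 1) + 1 := by
    intro i hi
    obtain ⟨j, hj, h1, h2⟩ := h i hi
    obtain ⟨hi1, hi2⟩ := ht i hi.le
    obtain ⟨hi3, hi4⟩ := ht (i + 1) hi
    have hcase : (q j = p i ∧ q (j + 1) = p (i + 1)) ∨ (q j = p (i + 1) ∧ q (j + 1) = p i) := by
      omega
    rcases hcase with ⟨h3, h4⟩ | ⟨h3, h4⟩
    · left
      rw [← hq.2 j hj.le (t i) hi1 (h3.trans hi2.symm),
        ← hq.2 (j + 1) hj (t (i + 1)) hi3 (h4.trans hi4.symm)]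
    · right
      rw [← hq.2 j hj.le (t (i + 1)) hi3 (h3.trans hi4.symm),
        ← hq.2 (j + 1) hj (t i) hi1 (h4.trans hi2.symm)]
  rcases htl.eq_id_or_eq_rev hstep with h1 | h1
  · left; intro i hi; rw [← (ht i hi).2, h1 i hi]
  · right; intro i hi; rw [← (ht i hi).2, h1 i hi]

/-! ### Permutations as paths, their symmetries and the maximal product -/

/-- The values of a permutation of `0, …, k` as a function on the natural numbers. -/
def pathOf {k : ℕ} (π : Equiv.Perm (Fin (k + 1))) (i : ℕ) : ℕ := π (Fin.ofNat (k + 1) i)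

lemma pathOf_coe {k : ℕ} (π : Equiv.Perm (Fin (k + 1))) (i : Fin (k + 1)) : pathOf π i = π i := by
  simp [pathOf]

lemma pathOf_of_lt {k i : ℕ} (π : Equiv.Perm (Fin (k + 1))) (hi : i < k + 1) :
    pathOf π i = π ⟨i, hi⟩ := pathOf_coe π ⟨i, hi⟩

lemma isListing_pathOf {k : ℕ} (π : Equiv.Perm (Fin (k + 1))) : IsListing (pathOf π) k := by
  refine ⟨fun i _ => Nat.lt_succ_iff.1 (π _).2, fun i hi j hj h => ?_⟩
  rw [pathOf_of_lt π (by omega), pathOf_of_lt π (by omega)] at h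
  exact Fin.mk.inj_iff.1 (π.injective (Fin.ext h))

lemma perm_ext_pathOf {k : ℕ} {π τ : Equiv.Perm (Fin (k + 1))}
    (h : ∀ i ≤ k, pathOf π i = pathOf τ i) : π = τ := by
  ext i
  rw [← pathOf_coe, ← pathOf_coe, h i (by omega)]

lemma pathOf_mirrorImage {k i : ℕ} (π : Equiv.Perm (Fin (k + 1))) (hi : i ≤ k) :
    pathOf (mirrorImage π) i = pathOf π (k - i) := by
  rw [pathOf_of_lt _ (by omega), pathOf_of_lt π (by omega)]
  simp only [mirrorImage, Equiv.trans_apply, Fin.revPerm_apply]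
  congr 2
  ext
  simp

/-- The permutation `i ↦ n + 1 - π i`. -/
def reflectValues {k : ℕ} (π : Equiv.Perm (Fin (k + 1))) : Equiv.Perm (Fin (k + 1)) :=
  π.trans Fin.revPerm

lemma pathOf_reflectValues {k i : ℕ} (π : Equiv.Perm (Fin (k + 1))) :
    pathOf (reflectValues π) i = k - pathOf π i := by
  simp [pathOf, reflectValues]

lemma reflectValues_reflectValues {k : ℕ} (π : Equiv.Perm (Fin (k + 1))) :
    reflectValues (reflectValues π) = π := by
  ext i; simp [reflectValues]

lemma reflectValues_mirrorImage {k : ℕ} (π : Equiv.Perm (Fin (k + 1))) :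
    reflectValues (mirrorImage π) = mirrorImage (reflectValues π) := rfl

lemma mirrorImage_mirrorImage {n : ℕ} (π : Equiv.Perm (Fin n)) :
    mirrorImage (mirrorImage π) = π := by
  ext i; simp [mirrorImage]

lemma edgeLength_reflectValues {k i : ℕ} (π : Equiv.Perm (Fin (k + 1))) (hi : i < k) :
    edgeLength (pathOf (reflectValues π)) i = edgeLength (pathOf π) i := by
  have h1 := (isListing_pathOf π).1 i hi.le
  have h2 := (isListing_pathOf π).1 (i + 1) hi
  simp only [edgeLength, pathOf_reflectValues]
  omega

lemma edgesWithin_reflectValues {k a b : ℕ} (π : Equiv.Perm (Fin (k + 1))) (hab : a ≤ b)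
    (hb : b ≤ k) :
    edgesWithin (pathOf (reflectValues π)) k a b = edgesWithin (pathOf π) k (k - b) (k - a) := by
  refine sum_congr rfl fun i hi => ?_
  rw [mem_range] at hi
  have h1 := (isListing_pathOf π).1 i hi.le
  have h2 := (isListing_pathOf π).1 (i + 1) hi
  simp only [pathOf_reflectValues]
  split_ifs <;> omega

/-- The product of the edge lengths of a permutation. -/
def lengthProd {k : ℕ} (π : Equiv.Perm (Fin (k + 1))) : ℕ :=
  ∏ i ∈ range k, edgeLength (pathOf π) i

lemma lengthProd_reflectValues {k : ℕ} (π : Equiv.Perm (Fin (k + 1))) :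
    lengthProd (reflectValues π) = lengthProd π :=
  prod_congr rfl fun _ hi => edgeLength_reflectValues π (mem_range.1 hi)

lemma lengthProd_mirrorImage {k : ℕ} (π : Equiv.Perm (Fin (k + 1))) :
    lengthProd (mirrorImage π) = lengthProd π := by
  rw [lengthProd, lengthProd, ← prod_range_reflect]
  refine prod_congr rfl fun i hi => ?_
  rw [mem_range] at hi
  rw [edgeLength, pathOf_mirrorImage π (by omega), pathOf_mirrorImage π (by omega),
    show k - (k - 1 - i) = i + 1 by omega, show k - (k - 1 - i + 1) = i by omega,
    max_comm, min_comm, edgeLength]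

lemma edgeLength_pos {p : ℕ → ℕ} {k i : ℕ} (hp : IsListing p k) (hi : i < k) :
    0 < edgeLength p i := by
  have := hp.ne_succ hi
  rw [edgeLength]; omega

lemma sum_log_eq_log_lengthProd {k : ℕ} (π : Equiv.Perm (Fin (k + 1))) :
    ∑ i ∈ range k, Real.log (edgeLength (pathOf π) i) = Real.log (lengthProd π) := by
  rw [lengthProd, Nat.cast_prod, Real.log_prod]
  intro i hi
  have := edgeLength_pos (isListing_pathOf π) (mem_range.1 hi)
  positivity

lemma lengthProd_pos {k : ℕ} (π : Equiv.Perm (Fin (k + 1))) : 0 < lengthProd π :=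
  prod_pos fun _ hi => edgeLength_pos (isListing_pathOf π) (mem_range.1 hi)

/-- The first extremal permutation. -/
noncomputable def zigzagPerm (m : ℕ) : Equiv.Perm (Fin (2 * m + 1)) :=
  Equiv.ofBijective
    (fun i => ⟨zigzag m i, Nat.lt_succ_of_le ((isListing_zigzag m).1 i (by omega))⟩)
    (Finite.injective_iff_bijective.1 fun i j h =>
      Fin.ext ((isListing_zigzag m).2 i (by omega) j (by omega) (Fin.mk.inj_iff.1 h)))

lemma pathOf_zigzagPerm {m i : ℕ} (hi : i ≤ 2 * m) : pathOf (zigzagPerm m) i = zigzag m i := by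
  rw [pathOf_of_lt _ (by omega)]; rfl

lemma edgeLength_zigzagPerm {m i : ℕ} (hi : i < 2 * m) :
    edgeLength (pathOf (zigzagPerm m)) i = edgeLength (zigzag m) i := by
  rw [edgeLength, edgeLength, pathOf_zigzagPerm hi.le, pathOf_zigzagPerm hi]

lemma lengthProd_zigzagPerm {m : ℕ} (hm : 1 ≤ m) :
    lengthProd (zigzagPerm m) = m ^ m * (m + 1) * (m + 2) ^ (m - 1) := by
  rw [← prod_edgeLength_zigzag m hm]
  exact prod_congr rfl fun i hi => edgeLength_zigzagPerm (mem_range.1 hi)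

lemma sum_log_zigzag (m : ℕ) : ∑ i ∈ range (2 * m), Real.log (edgeLength (zigzag m) i) =
    Real.log (lengthProd (zigzagPerm m)) := by
  rw [← sum_log_eq_log_lengthProd]
  exact sum_congr rfl fun i hi => by rw [edgeLength_zigzagPerm (mem_range.1 hi)]

lemma lengthProd_le_of_edgesWithin {m : ℕ} (π : Equiv.Perm (Fin (2 * m + 1)))
    (h : ∀ c, 1 ≤ c → c ≤ m → 1 ≤ edgesWithin (pathOf π) (2 * m) c (c + m)) :
    lengthProd π ≤ lengthProd (zigzagPerm m) ∧ (lengthProd π = lengthProd (zigzagPerm m) →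
      π = zigzagPerm m ∨ π = mirrorImage (zigzagPerm m)) := by
  have hp := isListing_pathOf π
  obtain ⟨h1, h2⟩ := sum_log_le_zigzag hp h
  rw [sum_log_eq_log_lengthProd, sum_log_zigzag] at h1 h2
  have hpos := lengthProd_pos π
  refine ⟨?_, fun heq => ?_⟩
  · rw [Real.log_le_log_iff (by positivity)
      (by exact_mod_cast lengthProd_pos (zigzagPerm m))] at h1
    exact_mod_cast h1
  · have hz := isListing_zigzag m
    rcases hp.eq_or_eq_rev hz fun i hi => exists_edge_eq hp hz (h2 (by rw [heq])) hi with h3 | h3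
    · left
      exact perm_ext_pathOf fun i hi => by rw [h3 i hi, pathOf_zigzagPerm hi]
    · right
      exact perm_ext_pathOf fun i hi => by
        rw [h3 i hi, pathOf_mirrorImage _ hi, pathOf_zigzagPerm (by omega)]

theorem lengthProd_le {m : ℕ} (π : Equiv.Perm (Fin (2 * m + 1))) :
    lengthProd π ≤ lengthProd (zigzagPerm m) ∧ (lengthProd π = lengthProd (zigzagPerm m) →
      π = zigzagPerm m ∨ π = mirrorImage (zigzagPerm m) ∨ π = reflectValues (zigzagPerm m) ∨
      π = mirrorImage (reflectValues (zigzagPerm m))) := by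
  have hp := isListing_pathOf π
  by_cases h : ∀ c, 1 ≤ c → c ≤ m → 1 ≤ edgesWithin (pathOf π) (2 * m) c (c + m)
  · obtain ⟨h1, h2⟩ := lengthProd_le_of_edgesWithin π h
    exact ⟨h1, fun heq => by tauto⟩
  push Not at h
  obtain ⟨c, hc, hcm, h0⟩ := h
  rw [Nat.lt_one_iff] at h0
  rcases hcm.lt_or_eq with hlt | rfl
  · have h1 := sum_log_lt_zigzag hp hc hlt h0
    rw [sum_log_eq_log_lengthProd, sum_log_zigzag, Real.log_lt_log_iff
      (by exact_mod_cast lengthProd_pos π) (by exact_mod_cast lengthProd_pos (zigzagPerm m))] at h1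
    have h2 : lengthProd π < lengthProd (zigzagPerm m) := by exact_mod_cast h1
    exact ⟨h2.le, fun heq => absurd heq h2.ne⟩
  -- Here `[m, 2m]` is edge-free. After reflection `[0, m]` is, and by uniqueness no other interval
  -- of `m + 1` labels.
  · obtain ⟨h1, h2⟩ := lengthProd_le_of_edgesWithin (reflectValues π) (by
      intro a ha hac
      rw [edgesWithin_reflectValues π (by omega) (by omega), Nat.one_le_iff_ne_zero]
      intro h1
      rw [show 2 * c - (a + c) = c - a by omega, show 2 * c - a = c - a + c by omega] at h1
      have := eq_of_edgesWithin_eq_zero hp (by omega) le_rfl h1 h0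
      omega)
    rw [lengthProd_reflectValues] at h1 h2
    refine ⟨h1, fun heq => ?_⟩
    rcases h2 heq with h3 | h3
    · rw [← h3, reflectValues_reflectValues]; tauto
    · rw [← reflectValues_mirrorImage, ← h3, reflectValues_reflectValues]; tauto

/-! ### The stretch in terms of the product of edge lengths -/

lemma indexDiam_pair {n : ℕ} (x y : Fin n) :
    indexDiam {x, y} = max (x : ℕ) y - min (x : ℕ) y := by
  have hne : ({x, y} : Finset (Fin n)).Nonempty := ⟨x, by simp⟩
  rw [indexDiam, dif_pos hne]
  have h1 : ({x, y} : Finset (Fin n)).max' hne = max x y := by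
    simp [Finset.max'_insert]
  have h2 : ({x, y} : Finset (Fin n)).min' hne = min x y := by
    simp [Finset.min'_insert]
  rw [h1, h2]
  rcases le_total x y with h | h <;> simp [h]

lemma pair_castSucc_succ_injective (k : ℕ) :
    Function.Injective fun i : Fin k => ({i.castSucc, i.succ} : Finset (Fin (k + 1))) := by
  intro i j h
  have h' : ({i.castSucc, i.succ} : Finset (Fin (k + 1))) = {j.castSucc, j.succ} := h
  have h1 : i.castSucc ∈ ({j.castSucc, j.succ} : Finset (Fin (k + 1))) := by
    rw [← h']; simp
  have h2 : j.castSucc ∈ ({i.castSucc, i.succ} : Finset (Fin (k + 1))) := by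
    rw [h']; simp
  simp only [mem_insert, mem_singleton, Fin.ext_iff, Fin.val_castSucc, Fin.val_succ] at h1 h2
  exact Fin.ext (by omega)

lemma mulStretch_neighbourPairs {k : ℕ} (π : Equiv.Perm (Fin (k + 1))) :
    mulStretch (neighbourPairs k) π = (lengthProd π : ℝ) ^ (1 / (k : ℝ)) := by
  have hinj := pair_castSucc_succ_injective k
  rw [mulStretch, neighbourPairs, card_image_of_injective _ hinj, prod_image hinj.injOn,
    Finset.card_univ, Fintype.card_fin, lengthProd, Nat.cast_prod, ← Fin.prod_univ_eq_prod_range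
      (fun i => (edgeLength (pathOf π) i : ℝ))]
  congr 1
  refine Fintype.prod_congr _ _ fun i => ?_
  rw [image_insert, image_singleton, indexDiam_pair, indexDiam_pair, edgeLength,
    pathOf_of_lt π (by omega), pathOf_of_lt π (by omega)]
  simp
  rfl

lemma mulStretch_le_iff {k : ℕ} (hk : 0 < k) (π τ : Equiv.Perm (Fin (k + 1))) :
    mulStretch (neighbourPairs k) π ≤ mulStretch (neighbourPairs k) τ ↔
      lengthProd π ≤ lengthProd τ := by
  rw [mulStretch_neighbourPairs, mulStretch_neighbourPairs,
    Real.rpow_le_rpow_iff (Nat.cast_nonneg _) (Nat.cast_nonneg _) (by positivity), Nat.cast_le]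

/-! ### The extremal paths as readings of the two cycles -/

set_option maxHeartbeats 1000000 in
lemma cycleA_zigzag {m i : ℕ} (hi : i < 2 * m) :
    cycleA m (zigzag m i + 1) = zigzag m (i + 1) + 1 := by
  generalize hx : zigzag m i = x
  generalize hy : zigzag m (i + 1) = y
  simp only [zigzag, Nat.even_iff] at hx hy
  simp only [cycleA, Nat.even_iff, Nat.odd_iff]
  rcases Nat.mod_two_eq_zero_or_one i with hi2 | hi2
  · rw [if_pos hi2] at hx
    rw [if_neg (by omega)] at hy
    split_ifs at hx hy <;> (try omega) <;> split_ifs <;> omega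
  · rw [if_neg (by omega)] at hx
    rw [if_pos (by omega)] at hy
    split_ifs at hx hy <;> (try omega) <;> split_ifs <;> omega

set_option maxHeartbeats 1000000 in
lemma cycleB_zigzag {m i : ℕ} (hi : i < 2 * m) :
    -- The second cycle runs through the reflected zigzag backwards, which is why `β` is a mirror
    -- image of `reflectValues α`.
    cycleB m (2 * m - zigzag m (i + 1) + 1) = 2 * m - zigzag m i + 1 := by
  generalize hx : zigzag m i = x
  generalize hy : zigzag m (i + 1) = y
  simp only [zigzag, Nat.even_iff] at hx hy
  simp only [cycleB, Nat.even_iff, Nat.odd_iff]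
  rcases Nat.mod_two_eq_zero_or_one i with hi2 | hi2
  · rw [if_pos hi2] at hx
    rw [if_neg (by omega)] at hy
    split_ifs at hx hy <;> (try omega) <;> split_ifs <;> omega
  · rw [if_neg (by omega)] at hx
    rw [if_pos (by omega)] at hy
    split_ifs at hx hy <;> (try omega) <;> split_ifs <;> omega

lemma zigzag_zero (m : ℕ) : zigzag m 0 = m := by simp [zigzag]

lemma zigzag_last {m : ℕ} (hm : 1 ≤ m) : zigzag m (2 * m) = m - 1 := by
  simp only [zigzag, Nat.even_iff]
  split_ifs <;> omega

lemma readsCycle_of_pathOf {k c : ℕ} {ρ : ℕ → ℕ} {π : Equiv.Perm (Fin (k + 1))}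
    (h0 : pathOf π 0 + 1 = c) (h : ∀ i < k, ρ (pathOf π i + 1) = pathOf π (i + 1) + 1)
    (hlast : ρ (pathOf π k + 1) = c) : ReadsCycle ρ c π := by
  refine ⟨h0, fun i => ?_⟩
  rw [← pathOf_coe, ← pathOf_coe]
  by_cases hi : i = Fin.last k
  · subst hi
    rw [finRotate_last, Fin.val_last, hlast, ← h0]
    rfl
  · have hik : (i : ℕ) < k := Fin.val_lt_last hi
    rw [coe_finRotate_of_ne_last hi, h i hik]

lemma readsCycle_cycleA {m : ℕ} (hm : 1 ≤ m) : ReadsCycle (cycleA m) (m + 1) (zigzagPerm m) := by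
  refine readsCycle_of_pathOf ?_ (fun i hi => ?_) ?_
  · rw [pathOf_zigzagPerm (by omega), zigzag_zero]
  · rw [pathOf_zigzagPerm hi.le, pathOf_zigzagPerm hi, cycleA_zigzag hi]
  · rw [pathOf_zigzagPerm le_rfl, zigzag_last hm, Nat.sub_add_cancel hm]
    simp [cycleA]

lemma pathOf_mirrorImage_reflectValues_zigzagPerm {m i : ℕ} (hi : i ≤ 2 * m) :
    pathOf (mirrorImage (reflectValues (zigzagPerm m))) i = 2 * m - zigzag m (2 * m - i) := by
  rw [pathOf_mirrorImage _ hi, pathOf_reflectValues, pathOf_zigzagPerm (by omega)]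

lemma readsCycle_cycleB {m : ℕ} (hm : 1 ≤ m) :
    ReadsCycle (cycleB m) (m + 2) (mirrorImage (reflectValues (zigzagPerm m))) := by
  refine readsCycle_of_pathOf ?_ (fun i hi => ?_) ?_
  · rw [pathOf_mirrorImage_reflectValues_zigzagPerm (by omega), Nat.sub_zero, zigzag_last hm]
    omega
  · rw [pathOf_mirrorImage_reflectValues_zigzagPerm hi.le,
      pathOf_mirrorImage_reflectValues_zigzagPerm hi,
      show 2 * m - i = 2 * m - (i + 1) + 1 by omega, cycleB_zigzag (by omega)]
  · rw [pathOf_mirrorImage_reflectValues_zigzagPerm le_rfl, Nat.sub_self, zigzag_zero,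
      show 2 * m - m + 1 = m + 1 by omega]
    simp [cycleB]

/-! ### The main theorem -/

theorem mainTheorem1 (m : ℕ) (hm : 1 < 2 * m + 1) :
    ∃ α β : Equiv.Perm (Fin (2 * m + 1)),
      ReadsCycle (cycleA m) (m + 1) α ∧
      ReadsCycle (cycleB m) (m + 2) β ∧
      IsGreatest
        (Set.range fun π : Equiv.Perm (Fin (2 * m + 1)) => mulStretch (neighbourPairs (2 * m)) π)
        (((m : ℝ) ^ m * (m + 1) * (m + 2) ^ (m - 1)) ^ (1 / (((2 * m + 1 : ℕ) : ℝ) - 1))) ∧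
      {π : Equiv.Perm (Fin (2 * m + 1)) |
          mulStretch (neighbourPairs (2 * m)) π =
            ((m : ℝ) ^ m * (m + 1) * (m + 2) ^ (m - 1)) ^ (1 / (((2 * m + 1 : ℕ) : ℝ) - 1))} =
        {α, β, mirrorImage α, mirrorImage β} ∧
      ({α, β, mirrorImage α, mirrorImage β} : Set (Equiv.Perm (Fin (2 * m + 1)))).ncard = 4 := by
  have hm1 : 1 ≤ m := by omega
  have hk : 0 < 2 * m := by omega
  set α := zigzagPerm m with hα
  set β := mirrorImage (reflectValues α) with hβ
  have hmax : ((m : ℝ) ^ m * (m + 1) * (m + 2) ^ (m - 1)) ^ (1 / (((2 * m + 1 : ℕ) : ℝ) - 1)) =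
      mulStretch (neighbourPairs (2 * m)) α := by
    rw [mulStretch_neighbourPairs, lengthProd_zigzagPerm hm1]
    push_cast
    rw [add_sub_cancel_right]
  have hprod : ∀ π : Equiv.Perm (Fin (2 * m + 1)), mulStretch (neighbourPairs (2 * m)) π =
      mulStretch (neighbourPairs (2 * m)) α ↔ lengthProd π = lengthProd α := by
    intro π
    rw [le_antisymm_iff, mulStretch_le_iff hk, mulStretch_le_iff hk, ← le_antisymm_iff]
  refine ⟨α, β, readsCycle_cycleA hm1, readsCycle_cycleB hm1, ?_, ?_, ?_⟩
  · rw [hmax]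
    refine ⟨⟨α, rfl⟩, ?_⟩
    rintro _ ⟨π, rfl⟩
    exact (mulStretch_le_iff hk π α).2 (lengthProd_le π).1
  · rw [hmax]
    ext π
    rw [Set.mem_ofPred_eq, hprod]
    simp only [Set.mem_insert_iff, Set.mem_singleton_iff]
    constructor
    · intro h
      have h1 := (lengthProd_le π).2 h
      rw [hβ, mirrorImage_mirrorImage]
      tauto
    · rintro (rfl | rfl | rfl | rfl) <;>
        simp only [hβ, lengthProd_mirrorImage, lengthProd_reflectValues]
  · have hα0 : pathOf α 0 = m := by rw [hα, pathOf_zigzagPerm (by omega), zigzag_zero]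
    have hα1 : pathOf α (2 * m) = m - 1 := by rw [hα, pathOf_zigzagPerm le_rfl, zigzag_last hm1]
    have hβ0 : pathOf β 0 = m + 1 := by
      rw [hβ, pathOf_mirrorImage_reflectValues_zigzagPerm (by omega), Nat.sub_zero, zigzag_last hm1]
      omega
    have hβ1 : pathOf β (2 * m) = m := by
      rw [hβ, pathOf_mirrorImage_reflectValues_zigzagPerm le_rfl, Nat.sub_self, zigzag_zero]
      omega
    have hmα0 : pathOf (mirrorImage α) 0 = m - 1 := by
      rw [pathOf_mirrorImage _ (by omega), Nat.sub_zero, hα1]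
    have hmβ0 : pathOf (mirrorImage β) 0 = m := by
      rw [pathOf_mirrorImage _ (by omega), Nat.sub_zero, hβ1]
    have hmβ1 : pathOf (mirrorImage β) (2 * m) = m + 1 := by
      rw [pathOf_mirrorImage _ le_rfl, Nat.sub_self, hβ0]
    -- The four permutations are told apart by their first labels, except `α` and `mirrorImage β`,
    -- which both begin with `m` and differ at the last place.
    have hne : ∀ {σ τ : Equiv.Perm (Fin (2 * m + 1))} (i : ℕ), pathOf σ i ≠ pathOf τ i → σ ≠ τ :=
      fun i h h' => h (by rw [h'])
    have h12 : α ≠ β := hne 0 (by omega)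
    have h13 : α ≠ mirrorImage α := hne 0 (by omega)
    have h14 : α ≠ mirrorImage β := hne (2 * m) (by omega)
    have h23 : β ≠ mirrorImage α := hne 0 (by omega)
    have h24 : β ≠ mirrorImage β := hne 0 (by omega)
    have h34 : mirrorImage α ≠ mirrorImage β := hne 0 (by omega)
    rw [Set.ncard_insert_of_notMem (by simp [h12, h13, h14]),
      Set.ncard_insert_of_notMem (by simp [h23, h24]), Set.ncard_pair h34]
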